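/- Let $\mathscr Q_n$ be a non-singular quadric of $\mathrm{PG}(n,2)$ of projective index $g\ge 1$ (the largest projective dimension of a subspace contained in $\mathscr Q_n$), and call the $g$-spaces contained in $\mathscr Q_n$ its generators. Let $0\le s<g$ and let $\alpha_s$ be an $s$-dimensional projective subspace contained in $\mathscr Q_n$. Let $\Gamma$ be the point-graph of $\mathscr Q_n$: its vertices are the points of $\mathscr Q_n$, two distinct points being adjacent when they lie on a line contained in $\mathscr Q_n$. Let $\mathcal X_s$ be the set of points of $\mathscr Q_n\setminus\alpha_s$ that lie in some $(s+1)$-space $W$ with $\alpha_s\subset W\subset\mathscr Q_n$. Let $\Gamma_s$ be the graph obtained from $\Gamma$ by the Godsil–McKay construction: for each vertex $R\notin\mathcal X_s$ with exactly $\frac12|\mathcal X_s|$ neighbours in $\mathcal X_s$, these edges are deleted and $R$ is joined to the other $\frac12|\mathcal X_s|$ vertices of $\mathcal X_s$; all other adjacencies are unchanged. Subspaces are identified with their sets of points. A $g$-clique is a clique of $\Gamma_s$ with exactly $2^{g+1}-1$ vertices. Then: 1. (Class A) If $\Sigma$ is a generator containing $\alpha_s$, then $\Sigma$ is a $g$-clique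 of $\Gamma_s$. 2. (Class B) If $\Sigma,\Pi$ are generators with $\alpha_s\subseteq\Sigma$, $\alpha_s\not\subseteq\Pi$ and $\dim(\Sigma\cap\Pi)=g-1$, then $$(\alpha_s\cap\Pi)\ \cup\ \bigl(\Sigma\setminus(\alpha_s\cup\Pi)\bigr)\ \cup\ (\Pi\setminus\Sigma)$$ is a $g$-clique of $\Gamma_s$, and its three parts have $2^s-1$, $2^g-2^s$ and $2^g$ points respectively. 3. Every $g$-clique of $\Gamma_s$ is of Class A or of Class B. 4. The maximum size of a clique of $\Gamma_s$ is $2^{g+1}-1$, and every maximal clique of $\Gamma_s$, meaning a clique of maximum size, is a $g$-clique of Class A or of Class B. -/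

import Mathlib

open scoped LinearAlgebra.Projectivization

namespace BinaryQuadric

/-- Quadratic forms in `n + 1` variables over the field with two elements; their zero sets are the
quadrics of `PG(n,2)`. -/
abbrev Form (n : ℕ) : Type := QuadraticForm (ZMod 2) (Fin (n + 1) → ZMod 2)

/-- Subspaces of `PG(n,2)`, given by linear subspaces of the underlying vector space. A projective
subspace of projective dimension `k` is a linear subspace of `finrank` equal to `k + 1`. -/
abbrev Space (n : ℕ) : Type := Submodule (ZMod 2) (Fin (n + 1) → ZMod 2)

variable {n : ℕ}

/-- The set of points of `PG(n,2)` on the quadric with equation `Q = 0`. -/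
def quadric (Q : Form n) : Set (ℙ (ZMod 2) (Fin (n + 1) → ZMod 2)) :=
  {p | Q p.rep = 0}

/-- The points of the quadric, as a type. -/
abbrev QPoint (Q : Form n) : Type := {p : ℙ (ZMod 2) (Fin (n + 1) → ZMod 2) // p ∈ quadric Q}

/-- The points of the quadric that lie in the projective subspace `W`. -/
def pts (Q : Form n) (W : Space n) : Set (QPoint Q) :=
  {p | p.1 ∈ W.projectivization}

/-- The projective subspace `W` is contained in the quadric. -/
def LiesIn (Q : Form n) (W : Space n) : Prop :=
  ∀ v ∈ W, Q v = 0

/-- `g` is the projective index of the quadric: the largest (projective) dimension of a subspace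
contained in the quadric. -/
def IsProjectiveIndex (Q : Form n) (g : ℕ) : Prop :=
  IsGreatest {k : ℕ | ∃ W : Space n, LiesIn Q W ∧ Module.finrank (ZMod 2) W = k + 1} g

/-- For a quadric of projective index `g`, a generator is a `g`-space contained in the quadric. -/
def IsGenerator (Q : Form n) (g : ℕ) (W : Space n) : Prop :=
  LiesIn Q W ∧ Module.finrank (ZMod 2) W = g + 1

/-- The point-graph of the quadric: two distinct points are adjacent when they lie on a common line
contained in the quadric. -/
def pointGraph (Q : Form n) : SimpleGraph (QPoint Q) where
  Adj p q := p ≠ q ∧ ∃ L : Space n, Module.finrank (ZMod 2) L = 2 ∧ LiesIn Q L ∧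
    p ∈ pts Q L ∧ q ∈ pts Q L
  symm := ⟨fun _ _ h => ⟨h.1.symm, h.2.imp fun _ hL => ⟨hL.1, hL.2.1, hL.2.2.2, hL.2.2.1⟩⟩⟩
  loopless := ⟨fun _ h => h.1 rfl⟩

/-- The vertex `y` lies outside `X` and is adjacent to exactly half of the vertices of `X`. -/
def HalfAdj {V : Type*} (G : SimpleGraph V) (X : Set V) (y : V) : Prop :=
  y ∉ X ∧ 2 * (G.neighborSet y ∩ X).ncard = X.ncard

/-- The pair `u, v` is one of those whose adjacency is changed by the construction below. -/
def Switched {V : Type*} (G : SimpleGraph V) (X : Set V) (u v : V) : Prop :=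
  (u ∈ X ∧ HalfAdj G X v) ∨ (v ∈ X ∧ HalfAdj G X u)

/-- The Godsil-McKay construction for the partition of the vertices into `X` and its complement:
each vertex outside `X` that is adjacent to exactly half of `X` is disconnected from these and
joined to the other half of `X`; all other adjacencies are unchanged. -/
def godsilMcKay {V : Type*} (G : SimpleGraph V) (X : Set V) : SimpleGraph V where
  Adj u v := (Switched G X u v ∧ ¬ G.Adj u v) ∨ (¬ Switched G X u v ∧ G.Adj u v)
  symm := ⟨fun u v h => by
    have e : Switched G X v u ↔ Switched G X u v := or_comm
    rw [e, G.adj_comm v u]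
    exact h⟩
  loopless := ⟨fun v h => by
    rcases h with ⟨h1 | h1, -⟩ | ⟨-, h2⟩
    · exact h1.2.1 h1.1
    · exact h1.2.1 h1.1
    · exact G.irrefl h2⟩

/-- For a subspace `A` of dimension `s` contained in the quadric: the points of the quadric outside
`A` that lie in some `(s+1)`-space that contains `A` and is contained in the quadric. -/
def typeTwo (Q : Form n) (A : Space n) : Set (QPoint Q) :=
  {p | p ∉ pts Q A ∧ ∃ W : Space n, A ≤ W ∧
    Module.finrank (ZMod 2) W = Module.finrank (ZMod 2) A + 1 ∧ LiesIn Q W ∧ p ∈ pts Q W}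

/-- The graph `Γ_s` obtained from an `s`-space `A` contained in the quadric. -/
def gammaGraph (Q : Form n) (A : Space n) : SimpleGraph (QPoint Q) :=
  godsilMcKay (pointGraph Q) (typeTwo Q A)

/-- `C` is the set of points of a generator that contains `A`. -/
def IsClassA (Q : Form n) (g : ℕ) (A : Space n) (C : Set (QPoint Q)) : Prop :=
  ∃ S : Space n, IsGenerator Q g S ∧ A ≤ S ∧ C = pts Q S

/-- `S` and `P` are generators, `S` contains `A`, `P` does not contain `A`, and `S`, `P` meet in
a `(g-1)`-space (that is, in a linear subspace of rank `g`). -/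
def IsClassBPair (Q : Form n) (g : ℕ) (A S P : Space n) : Prop :=
  IsGenerator Q g S ∧ IsGenerator Q g P ∧ A ≤ S ∧ ¬ A ≤ P ∧
    Module.finrank (ZMod 2) (S ⊓ P : Space n) = g

/-- The points of `A ∩ P`, those of `S` outside `A ∪ P`, and those of `P` outside `S`. -/
def classBSet (Q : Form n) (A S P : Space n) : Set (QPoint Q) :=
  (pts Q A ∩ pts Q P) ∪ (pts Q S \ (pts Q A ∪ pts Q P)) ∪ (pts Q P \ pts Q S)

/-- `C` is the set built from two generators as above. -/
def IsClassB (Q : Form n) (g : ℕ) (A : Space n) (C : Set (QPoint Q)) : Prop :=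
  ∃ S P : Space n, IsClassBPair Q g A S P ∧ C = classBSet Q A S P

/-- A `g`-clique of `Γ_s`: a clique with exactly `2^(g+1) - 1` vertices. -/
def IsGClique (Q : Form n) (g : ℕ) (A : Space n) (C : Set (QPoint Q)) : Prop :=
  (gammaGraph Q A).IsClique C ∧ C.ncard = 2 ^ (g + 1) - 1

end BinaryQuadric

/-! Over the field with two elements a point of the quadric is a nonzero singular vector, and
distinct points are adjacent when the polar form vanishes. The set `typeTwo Q A` is then the
singular part of A^⊥ \ A. Points of A are adjacent to all of it. A point y outside A^⊥ is adjacent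
to exactly half, because adding some a ∈ A with polar(a, y) = 1 exchanges neighbours and
non-neighbours. So the construction reverses orthogonality exactly between A^⊥ \ A and the
complement of A^⊥ (`gammaGraph_adj`).

A clique C inside A^⊥ spans a totally singular subspace, which gives Class A. Otherwise let X = C ∩
A^⊥ \ A and Y = C \ A^⊥. Every x ∈ X pairs to 1 with every y ∈ Y, so sums of two members of X are
orthogonal to Y, and T = `cliqueSpan Q A C` is totally singular. Put T' = T ∩ A^⊥ and S = T' + A; S
is totally singular of the same dimension as T (`swap_totallySingular`). Now C ∩ A lies in T' ∩ A
and Y in T \ T'. If X is empty, or can be translated into T' \ A, then |C| ≤ |T| - 1. A translation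
exists when some x ∈ X lies in S; if not, x fails to be orthogonal to T' or S is not maximal, and
either way C is strictly too small. Equality forces T to be a generator and T' a hyperplane of it,
and C is the Class B set of S and T (`vecClique_of_notMem_perp`). -/

namespace BinaryQuadric

/-! ### Totally singular subspaces and orthogonality -/

section VectorSpace

variable {V : Type*} [AddCommGroup V] [Module (ZMod 2) V]

open QuadraticMap Module

/-- The subspace of vectors orthogonal, for the polar form of `Q`, to all vectors of a set. -/
def perp (Q : QuadraticForm (ZMod 2) V) (s : Set V) : Submodule (ZMod 2) V where
  carrier := {v | ∀ w ∈ s, polar Q v w = 0}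
  add_mem' hu hv w hw := by rw [polar_add_left, hu w hw, hv w hw, add_zero]
  zero_mem' w _ := polar_zero_left Q w
  smul_mem' c v hv w hw := by rw [polar_smul_left, hv w hw, smul_zero]

/-- A subspace on which the quadratic form vanishes. -/
def TotallySingular (Q : QuadraticForm (ZMod 2) V) (W : Submodule (ZMod 2) V) : Prop :=
  ∀ v ∈ W, Q v = 0

variable {Q : QuadraticForm (ZMod 2) V} {A S P T W : Submodule (ZMod 2) V} {g : ℕ}

theorem zmod_two_eq_one {z : ZMod 2} : z ≠ 0 → z = 1 := by
  revert z; decide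

theorem add_self_eq_zero' (v : V) : v + v = 0 := by
  rw [← two_smul (ZMod 2) v, show (2 : ZMod 2) = 0 from rfl, zero_smul]

theorem add_add_cancel_left' (u v : V) : u + (u + v) = v := by
  rw [← add_assoc, add_self_eq_zero', zero_add]

theorem mem_perp {s : Set V} {v : V} : v ∈ perp Q s ↔ ∀ w ∈ s, polar Q v w = 0 := Iff.rfl

theorem map_add_eq_zero {u v : V} (hu : Q u = 0) (hv : Q v = 0) (h : polar Q u v = 0) :
    Q (u + v) = 0 := by
  rw [QuadraticMap.map_add Q, hu, hv, h]; simp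

theorem polar_self_eq_zero (v : V) : polar Q v v = 0 := by
  rw [polar_self, ← Nat.cast_smul_eq_nsmul (ZMod 2) 2, show ((2 : ℕ) : ZMod 2) = 0 from rfl,
    zero_smul]

theorem TotallySingular.polar_eq_zero (hW : TotallySingular Q W) {u v : V} (hu : u ∈ W)
    (hv : v ∈ W) : polar Q u v = 0 := by
  simp [polar, hW _ hu, hW _ hv, hW _ (W.add_mem hu hv)]

theorem TotallySingular.mono (hW : TotallySingular Q W) (h : T ≤ W) : TotallySingular Q T :=
  fun v hv => hW v (h hv)

theorem TotallySingular.le_perp (hW : TotallySingular Q W) : W ≤ perp Q W :=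
  fun _ hu _ hv => hW.polar_eq_zero hu hv

theorem perp_anti {s t : Set V} (h : s ⊆ t) : perp Q t ≤ perp Q s :=
  fun _ hv w hw => hv w (h hw)

theorem le_perp_comm (h : T ≤ perp Q W) : W ≤ perp Q T :=
  fun w hw t ht => by rw [polar_comm]; exact h ht w hw

theorem perp_span (s : Set V) : perp Q (Submodule.span (ZMod 2) s : Set V) = perp Q s := by
  refine le_antisymm (perp_anti Submodule.subset_span) ?_
  have : Submodule.span (ZMod 2) s ≤ perp Q (perp Q s : Set V) :=
    Submodule.span_le.2 fun w hw v hv => by rw [polar_comm]; exact hv w hw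
  exact le_perp_comm this

/-- Orthogonality passes to the span on both sides, and on orthogonal vectors `Q` is additive. -/
theorem totallySingular_span {s : Set V} (h0 : ∀ v ∈ s, Q v = 0)
    (h : ∀ u ∈ s, ∀ v ∈ s, polar Q u v = 0) :
    TotallySingular Q (Submodule.span (ZMod 2) s) := by
  have hle : Submodule.span (ZMod 2) s ≤ perp Q (Submodule.span (ZMod 2) s : Set V) := by
    rw [perp_span]
    exact Submodule.span_le.2 h
  intro v hv
  induction hv using Submodule.span_induction with
  | mem x hx => exact h0 x hx
  | zero => exact QuadraticMap.map_zero Q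
  | add x y hx hy ihx ihy => exact map_add_eq_zero ihx ihy (hle hx y hy)
  | smul c x _ ih => rw [QuadraticMap.map_smul, ih, smul_zero]

theorem TotallySingular.sup (hS : TotallySingular Q S) (hT : TotallySingular Q T)
    (h : S ≤ perp Q T) : TotallySingular Q (S ⊔ T) := by
  intro v hv
  obtain ⟨s, hs, t, ht, rfl⟩ := Submodule.mem_sup.1 hv
  exact map_add_eq_zero (hS s hs) (hT t ht) (h hs t ht)

/-! ### Switched pairs, maximality and dimension exchange -/

/-- The pairs of vectors whose adjacency is changed. -/
def SwitchedVec (Q : QuadraticForm (ZMod 2) V) (A : Submodule (ZMod 2) V) (u v : V) : Prop :=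
  (u ∈ perp Q A ∧ u ∉ A ∧ v ∉ perp Q A) ∨ (v ∈ perp Q A ∧ v ∉ A ∧ u ∉ perp Q A)

/-- Sets of singular vectors whose members are pairwise orthogonal, except that switched pairs are
not. -/
def IsVecClique (Q : QuadraticForm (ZMod 2) V) (A : Submodule (ZMod 2) V) (C : Set V) : Prop :=
  (∀ u ∈ C, Q u = 0) ∧ ∀ u ∈ C, ∀ v ∈ C, polar Q u v = 0 ↔ ¬ SwitchedVec Q A u v

theorem isVecClique_of_le (hA : A ≤ S) (hS : TotallySingular Q S) :
    IsVecClique Q A (S : Set V) := by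
  have : S ≤ perp Q A := hS.le_perp.trans (perp_anti hA)
  refine ⟨hS, fun u hu v hv => ?_⟩
  simp [SwitchedVec, hS.polar_eq_zero hu hv, this hu, this hv]

variable [Finite V]

theorem ncard_submodule (W : Submodule (ZMod 2) V) :
    (W : Set V).ncard = 2 ^ finrank (ZMod 2) W := by
  rw [← Nat.card_coe_set_eq]
  have := Module.natCard_eq_pow_finrank (K := ZMod 2) (V := W)
  rwa [Nat.card_zmod] at this

/-- A totally singular subspace of the largest dimension contains every singular vector that is
orthogonal to it. -/
theorem mem_of_maximal (hg : ∀ W, TotallySingular Q W → finrank (ZMod 2) W ≤ g + 1)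
    (hS : TotallySingular Q S) (hSg : finrank (ZMod 2) S = g + 1) {v : V} (hv : Q v = 0)
    (hvS : v ∈ perp Q S) : v ∈ S := by
  by_contra hn
  have h1 := Submodule.finrank_sup_span_singleton hn
  have h2 : TotallySingular Q (Submodule.span (ZMod 2) {v}) :=
    totallySingular_span (by simpa using hv) (by
      intro u hu w hw
      rw [Set.mem_singleton_iff] at hu hw
      rw [hu, hw, polar_self_eq_zero])
  have h3 : S ≤ perp Q (Submodule.span (ZMod 2) {v} : Set V) :=
    le_perp_comm (by simpa using hvS)
  have := hg _ (hS.sup h2 h3)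
  omega

/-- The restriction of the polar form to `T × A` has the same rank on both sides. -/
theorem finrank_add_finrank_inf_perp (Q : QuadraticForm (ZMod 2) V)
    (T A : Submodule (ZMod 2) V) :
    finrank (ZMod 2) T + finrank (ZMod 2) (A ⊓ perp Q T : Submodule (ZMod 2) V) =
      finrank (ZMod 2) A + finrank (ZMod 2) (T ⊓ perp Q A : Submodule (ZMod 2) V) := by
  have key : ∀ T A : Submodule (ZMod 2) V,
      finrank (ZMod 2) (T ⊓ perp Q A : Submodule (ZMod 2) V) =
        finrank (ZMod 2) (LinearMap.ker (Q.polarBilin.domRestrict₁₂ T A)) := by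
    intro T A
    have : T ⊓ perp Q A = (LinearMap.ker (Q.polarBilin.domRestrict₁₂ T A)).map T.subtype := by
      ext v
      simp only [Submodule.mem_inf, mem_perp, Submodule.mem_map, LinearMap.mem_ker]
      constructor
      · rintro ⟨hv, h⟩
        exact ⟨⟨v, hv⟩, LinearMap.ext fun a => h a a.2, rfl⟩
      · rintro ⟨t, ht, rfl⟩
        exact ⟨t.2, fun w hw => LinearMap.congr_fun ht ⟨w, hw⟩⟩
    rw [this, Submodule.finrank_map_subtype_eq]
  have h1 := LinearMap.finrank_range_add_finrank_ker (Q.polarBilin.domRestrict₁₂ T A)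
  have h2 := LinearMap.finrank_range_add_finrank_ker (Q.polarBilin.domRestrict₁₂ A T)
  -- Row rank equals column rank: by symmetry of the polar form, the pairing on A × T is the
  -- transpose of the one on T × A.
  have h3 : finrank (ZMod 2) (LinearMap.range (Q.polarBilin.domRestrict₁₂ A T)) =
      finrank (ZMod 2) (LinearMap.range (Q.polarBilin.domRestrict₁₂ T A)) := by
    rw [← LinearMap.finrank_range_dualMap_eq_finrank_range (Q.polarBilin.domRestrict₁₂ T A)]
    have : Q.polarBilin.domRestrict₁₂ A T =
        (Q.polarBilin.domRestrict₁₂ T A).dualMap ∘ₗ (Dual.eval (ZMod 2) A) := by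
      ext a t
      exact polar_comm Q a t
    rw [this, LinearMap.range_comp_of_range_eq_top]
    exact LinearMap.range_eq_top.2 (evalEquiv (ZMod 2) A).surjective
  rw [key, key]
  omega

/-- Replacing the part of `T` outside `perp A` by `A` keeps the dimension. -/
theorem swap_totallySingular (hT : TotallySingular Q T) (hA : TotallySingular Q A)
    (h : A ⊓ perp Q T ≤ T) :
    TotallySingular Q ((T ⊓ perp Q A) ⊔ A) ∧
      finrank (ZMod 2) ((T ⊓ perp Q A) ⊔ A : Submodule (ZMod 2) V) = finrank (ZMod 2) T := by
  refine ⟨(hT.mono inf_le_left).sup hA inf_le_right, ?_⟩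
  have h1 := Submodule.finrank_sup_add_finrank_inf_eq (T ⊓ perp Q A) A
  have h2 := finrank_add_finrank_inf_perp Q T A
  -- With this intersection identified, the dimension formula for the sum and the rank identity add
  -- up to dim T.
  have h3 : (T ⊓ perp Q A) ⊓ A = A ⊓ perp Q T :=
    le_antisymm (fun v hv => ⟨hv.2, hT.le_perp hv.1.1⟩)
      fun v hv => ⟨⟨h hv, hA.le_perp hv.1⟩, hv.1⟩
  rw [h3] at h1
  omega

/-- Every totally singular subspace lies in one of the largest dimension. -/
theorem exists_generator_ge (hg : ∀ W, TotallySingular Q W → finrank (ZMod 2) W ≤ g + 1)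
    (hS : TotallySingular Q S) (hSg : finrank (ZMod 2) S = g + 1) (hA : TotallySingular Q A) :
    ∃ G, TotallySingular Q G ∧ finrank (ZMod 2) G = g + 1 ∧ A ≤ G := by
  obtain ⟨h1, h2⟩ := swap_totallySingular hS hA
    fun v hv => mem_of_maximal hg hS hSg (hA v hv.1) hv.2
  exact ⟨_, h1, h2.trans hSg, le_sup_right⟩

/-! ### Class B sets -/

/-- A set of Class B, together with the zero vector. -/
def vecClassB (A S P : Submodule (ZMod 2) V) : Set V :=
  ((A : Set V) ∩ P) ∪ (S \ (A ∪ P)) ∪ (P \ S)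

section ClassB

variable (hg : ∀ W, TotallySingular Q W → finrank (ZMod 2) W ≤ g + 1)
  (hS : TotallySingular Q S) (hSg : finrank (ZMod 2) S = g + 1)
  (hP : TotallySingular Q P) (hPg : finrank (ZMod 2) P = g + 1)
  (hA : A ≤ S) (hAP : ¬ A ≤ P) (hSP : finrank (ZMod 2) (S ⊓ P : Submodule (ZMod 2) V) = g)

include hg hS hP hPg hSP in
-- If x were orthogonal to y, it would be orthogonal to S ∩ P and to y, hence to all of P, since S ∩
-- P is a hyperplane of P. Maximality of P would then put x in P.
theorem polar_ne_zero_of_mem_diff {x y : V} (hx : x ∈ S) (hxP : x ∉ P) (hy : y ∈ P)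
    (hyS : y ∉ S) : polar Q x y ≠ 0 := by
  intro h
  have h1 : S ⊓ P ≤ P ⊓ perp Q {x} := fun v hv =>
    ⟨hv.2, by rintro w rfl; exact hS.polar_eq_zero hv.1 hx⟩
  have h2 : S ⊓ P < P ⊓ perp Q {x} := lt_of_le_of_ne h1 fun he => hyS
    (he.ge (show y ∈ P ⊓ perp Q {x} from ⟨hy, by rintro w rfl; rwa [polar_comm]⟩)).1
  have h3 := Submodule.finrank_lt_finrank_of_lt h2
  have h4 : P ⊓ perp Q {x} = P := Submodule.eq_of_le_of_finrank_le inf_le_left (by omega)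
  refine hxP (mem_of_maximal hg hP hPg (hS x hx) fun w hw => ?_)
  rw [polar_comm]
  exact (inf_eq_left.1 h4) hw x rfl

include hg hS hP hPg hA hAP hSP in
-- The three parts lie in A, in A^⊥ \ A and outside A^⊥. Hence only pairs from the last two parts
-- are switched, and these are exactly the non-orthogonal ones.
theorem isVecClique_vecClassB : IsVecClique Q A (vecClassB A S P) := by
  have hSA : S ≤ perp Q A := hS.le_perp.trans (perp_anti hA)
  have hne := @polar_ne_zero_of_mem_diff V _ _ Q S P g _ hg hS hP hPg hSP
  have hY : ∀ y ∈ P, y ∉ S → y ∉ perp Q A := by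
    intro y hy hyS hyA
    obtain ⟨a, ha, haP⟩ := Set.not_subset.1 hAP
    exact hne (hA ha) haP hy hyS (by rw [polar_comm]; exact hyA a ha)
  refine ⟨?_, ?_⟩
  · rintro u ((⟨h, -⟩ | ⟨h, -⟩) | ⟨h, -⟩)
    exacts [hS u (hA h), hS u h, hP u h]
  · intro u hu v hv
    have hcomm := polar_comm Q u v
    unfold SwitchedVec
    rcases hu with (⟨hu1, hu2⟩ | ⟨hu1, hu2⟩) | ⟨hu1, hu2⟩ <;>
      rcases hv with (⟨hv1, hv2⟩ | ⟨hv1, hv2⟩) | ⟨hv1, hv2⟩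
    · simp_all [hS.polar_eq_zero (hA hu1) (hA hv1)]
    · have := hS.polar_eq_zero (hA hu1) hv1
      have := hSA (hA hu1)
      have := hSA hv1
      tauto
    · have := hP.polar_eq_zero hu2 hv1
      simp_all
    · have := hS.polar_eq_zero hu1 (hA hv1)
      have := hSA (hA hv1)
      have := hSA hu1
      tauto
    · have := hS.polar_eq_zero hu1 hv1
      have := hSA hv1
      have := hSA hu1
      tauto
    · have h1 : u ∉ A := fun h => hu2 (Or.inl h)
      have h2 : u ∉ P := fun h => hu2 (Or.inr h)
      have := hne hu1 h2 hv1 hv2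
      have := hY v hv1 hv2
      have := hSA hu1
      tauto
    · have := hP.polar_eq_zero hu1 hv2
      simp_all
    · have h1 : v ∉ A := fun h => hv2 (Or.inl h)
      have h2 : v ∉ P := fun h => hv2 (Or.inr h)
      have := hne hv1 h2 hu1 hu2
      have := hY u hu1 hu2
      have := hSA hv1
      rw [polar_comm]
      tauto
    · have := hP.polar_eq_zero hu1 hv1
      have := hY u hu1 hu2
      have := hY v hv1 hv2
      tauto

include hSg hPg hA hAP hSP in
theorem ncard_vecClassB {s : ℕ} (hAs : finrank (ZMod 2) A = s + 1) :
    ((A : Set V) ∩ P).ncard = 2 ^ s ∧ ((S : Set V) \ (A ∪ P)).ncard = 2 ^ g - 2 ^ s ∧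
      ((P : Set V) \ S).ncard = 2 ^ g := by
  have e1 := ncard_submodule (A ⊓ P)
  have h1 := Submodule.finrank_sup_add_finrank_inf_eq A (S ⊓ P)
  have h2 : A ⊓ (S ⊓ P) = A ⊓ P := by rw [← inf_assoc, inf_eq_left.2 hA]
  have h3 : finrank (ZMod 2) (A ⊔ S ⊓ P : Submodule (ZMod 2) V) ≤ g + 1 :=
    hSg ▸ Submodule.finrank_mono (sup_le hA inf_le_left)
  -- A ∩ P is a proper subspace of A, and by `h1` and `h3` its codimension in A is at most 1, so its
  -- rank is s.
  have h4 : finrank (ZMod 2) (A ⊓ P : Submodule (ZMod 2) V) < s + 1 :=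
    hAs ▸ Submodule.finrank_lt_finrank_of_lt (inf_lt_left.2 hAP)
  rw [h2] at h1
  rw [show finrank (ZMod 2) (A ⊓ P : Submodule (ZMod 2) V) = s by omega,
    Submodule.coe_inf] at e1
  have e2 := ncard_submodule (S ⊓ P)
  rw [hSP, Submodule.coe_inf] at e2
  have e3 := ncard_submodule S
  have e4 := ncard_submodule P
  have e5 := ncard_submodule A
  rw [hSg] at e3
  rw [hPg] at e4
  rw [hAs] at e5
  refine ⟨e1, ?_, ?_⟩
  · have i1 := Set.ncard_inter_add_ncard_sdiff_eq_ncard (S : Set V) (A ∪ P) (Set.toFinite _)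
    have i2 := Set.ncard_union_add_ncard_inter (A : Set V) (S ∩ P)
    have i3 : (S : Set V) ∩ (A ∪ P) = (A : Set V) ∪ ((S : Set V) ∩ P) := by
      rw [Set.inter_union_distrib_left, Set.inter_eq_right.2 (SetLike.coe_subset_coe.2 hA)]
    have i4 : (A : Set V) ∩ ((S : Set V) ∩ P) = (A : Set V) ∩ P := by
      rw [← Set.inter_assoc, Set.inter_eq_left.2 (SetLike.coe_subset_coe.2 hA)]
    rw [i4] at i2
    rw [i3] at i1
    rw [pow_succ] at e3 e5
    omega
  · have i1 := Set.ncard_inter_add_ncard_sdiff_eq_ncard (P : Set V) S (Set.toFinite _)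
    rw [Set.inter_comm] at i1
    rw [pow_succ] at e4
    omega

include hSg hPg hA hAP hSP in
theorem ncard_vecClassB_diff : (vecClassB A S P \ {0}).ncard = 2 ^ (g + 1) - 1 := by
  obtain ⟨s, hs⟩ : ∃ s, finrank (ZMod 2) A = s + 1 := by
    refine Nat.exists_eq_succ_of_ne_zero fun h => hAP ?_
    rw [Submodule.finrank_eq_zero.1 h]
    exact bot_le
  obtain ⟨h1, h2, h3⟩ := ncard_vecClassB hSg hPg hA hAP hSP hs
  have hsg : s + 1 ≤ g + 1 := hs ▸ hSg ▸ Submodule.finrank_mono hA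
  have h4 : 2 ^ s ≤ 2 ^ g := Nat.pow_le_pow_right (by norm_num) (by omega)
  have h0 : (0 : V) ∈ vecClassB A S P := Or.inl (Or.inl ⟨A.zero_mem, P.zero_mem⟩)
  rw [Set.ncard_sdiff_singleton_of_mem h0, vecClassB,
    Set.ncard_union_eq, Set.ncard_union_eq, h1, h2, h3, pow_succ]
  · omega
  · exact Set.disjoint_left.2 fun v hv hv' => hv'.2 (Or.inl hv.1)
  · refine Set.disjoint_left.2 ?_
    rintro v (hv | hv) hv'
    exacts [hv'.2 (hA hv.1), hv'.2 hv.1]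

end ClassB

end VectorSpace

end BinaryQuadric


namespace BinaryQuadric

/-! ### The clique bound and the case of equality -/

section CliqueBound

open QuadraticMap Module

variable {V : Type*} [AddCommGroup V] [Module (ZMod 2) V]
  {Q : QuadraticForm (ZMod 2) V} {A : Submodule (ZMod 2) V} {g : ℕ} {C : Set V}

/-- The subspace spanned by the members of the clique `C` outside `perp Q A`, the vectors of `A`
orthogonal to these, and the sums of two members of `C` in `perp Q A` outside `A`. -/
def cliqueSpan (Q : QuadraticForm (ZMod 2) V) (A : Submodule (ZMod 2) V) (C : Set V) :
    Submodule (ZMod 2) V :=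
  Submodule.span (ZMod 2) ((C \ perp Q A) ∪
    (((A : Set V) ∩ perp Q (C \ perp Q A)) ∪
      {v | ∃ x ∈ C, ∃ x' ∈ C, (x ∈ perp Q A ∧ x ∉ A) ∧ (x' ∈ perp Q A ∧ x' ∉ A) ∧ v = x + x'}))

theorem mem_cliqueSpan_of_notMem_perp {y : V} (hy : y ∈ C) (hyA : y ∉ perp Q A) :
    y ∈ cliqueSpan Q A C :=
  Submodule.subset_span (Or.inl ⟨hy, hyA⟩)

theorem inf_perp_le_cliqueSpan : A ⊓ perp Q (C \ perp Q A) ≤ cliqueSpan Q A C :=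
  fun _ ha => Submodule.subset_span (Or.inr (Or.inl ha))

theorem add_mem_cliqueSpan {x x' : V} (hx : x ∈ C) (hxA : x ∈ perp Q A ∧ x ∉ A) (hx' : x' ∈ C)
    (hxA' : x' ∈ perp Q A ∧ x' ∉ A) : x + x' ∈ cliqueSpan Q A C :=
  Submodule.subset_span (Or.inr (Or.inr ⟨x, hx, x', hx', hxA, hxA', rfl⟩))

theorem IsVecClique.polar_eq_one (hC : IsVecClique Q A C) {x y : V} (hx : x ∈ C) (hy : y ∈ C)
    (hxA : x ∈ perp Q A ∧ x ∉ A) (hyA : y ∉ perp Q A) : polar Q x y = 1 :=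
  zmod_two_eq_one fun h => (hC.2 x hx y hy).1 h (Or.inl ⟨hxA.1, hxA.2, hyA⟩)

theorem IsVecClique.polar_eq_zero_of_mem_perp (hC : IsVecClique Q A C) {x y : V} (hx : x ∈ C)
    (hy : y ∈ C) (hxA : x ∈ perp Q A) (hyA : y ∈ perp Q A) : polar Q x y = 0 :=
  (hC.2 x hx y hy).2 (by unfold SwitchedVec; tauto)

theorem IsVecClique.polar_eq_zero_of_notMem_perp (hC : IsVecClique Q A C) {x y : V} (hx : x ∈ C)
    (hy : y ∈ C) (hxA : x ∉ perp Q A) (hyA : y ∉ perp Q A) : polar Q x y = 0 :=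
  (hC.2 x hx y hy).2 (by unfold SwitchedVec; tauto)

theorem totallySingular_cliqueSpan (hA : TotallySingular Q A) (hC : IsVecClique Q A C) :
    TotallySingular Q (cliqueSpan Q A C) := by
  refine totallySingular_span ?_ ?_
  · rintro v (hv | hv | ⟨x, hx, x', hx', hxA, hxA', rfl⟩)
    · exact hC.1 v hv.1
    · exact hA v hv.1
    · exact map_add_eq_zero (hC.1 x hx) (hC.1 x' hx')
        (hC.polar_eq_zero_of_mem_perp hx hx' hxA.1 hxA'.1)
  · have h12 : ∀ y ∈ C \ perp Q A, ∀ a ∈ (A : Set V) ∩ perp Q (C \ perp Q A),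
        polar Q y a = 0 := fun y hy a ha => by rw [polar_comm]; exact ha.2 y hy
    have h13 : ∀ y ∈ C \ perp Q A, ∀ x ∈ C, ∀ x' ∈ C, x ∈ perp Q A ∧ x ∉ A →
        x' ∈ perp Q A ∧ x' ∉ A → polar Q y (x + x') = 0 := by
      intro y hy x hx x' hx' hxA hxA'
      -- Both pairings are 1, and 1 + 1 = 0.
      rw [polar_comm, polar_add_left, hC.polar_eq_one hx hy.1 hxA hy.2,
        hC.polar_eq_one hx' hy.1 hxA' hy.2]
      rfl
    have h23 : ∀ a ∈ (A : Set V) ∩ perp Q (C \ perp Q A), ∀ x x' : V, x ∈ perp Q A ∧ x ∉ A →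
        x' ∈ perp Q A ∧ x' ∉ A → polar Q a (x + x') = 0 := by
      intro a ha x x' hx hx'
      rw [polar_comm]
      exact (perp Q A).add_mem hx.1 hx'.1 a ha.1
    rintro u (hu | hu | ⟨x, hx, x', hx', hxA, hxA', rfl⟩) v
      (hv | hv | ⟨z, hz, z', hz', hzA, hzA', rfl⟩)
    · exact hC.polar_eq_zero_of_notMem_perp hu.1 hv.1 hu.2 hv.2
    · exact h12 u hu v hv
    · exact h13 u hu z hz z' hz' hzA hzA'
    · rw [polar_comm]; exact h12 v hv u hu
    · exact hA.polar_eq_zero hu.1 hv.1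
    · exact h23 u hu z z' hzA hzA'
    · rw [polar_comm]; exact h13 v hv x hx x' hx' hxA hxA'
    · rw [polar_comm]; exact h23 v hv x x' hxA hxA'
    · have h := fun {u v} hu hv => hC.polar_eq_zero_of_mem_perp (x := u) (y := v) hu hv
      rw [polar_add_left, polar_add_right, polar_add_right, h hx hz hxA.1 hzA.1,
        h hx hz' hxA.1 hzA'.1, h hx' hz hxA'.1 hzA.1, h hx' hz' hxA'.1 hzA'.1]
      simp

/-- This is the hypothesis of `swap_totallySingular`; it is why vectors of A orthogonal to Y are
among the generators of the span, even those not in C. -/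
theorem inf_perp_cliqueSpan_le : A ⊓ perp Q (cliqueSpan Q A C) ≤ cliqueSpan Q A C :=
  (inf_le_inf_left A (perp_anti fun _ hy => mem_cliqueSpan_of_notMem_perp hy.1 hy.2)).trans
    inf_perp_le_cliqueSpan

theorem finrank_eq_of_pow_le {W : Submodule (ZMod 2) V} (h : finrank (ZMod 2) W ≤ g + 1)
    (h' : 2 ^ (g + 1) - 1 ≤ 2 ^ finrank (ZMod 2) W - 1) : finrank (ZMod 2) W = g + 1 := by
  have h1 : 0 < 2 ^ finrank (ZMod 2) W := by positivity
  have h2 : 0 < 2 ^ (g + 1) := by positivity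
  exact le_antisymm h ((Nat.pow_le_pow_iff_right (by norm_num : 1 < 2)).1 (by omega))

variable [Finite V]

theorem ncard_submodule_diff_zero (W : Submodule (ZMod 2) V) :
    ((W : Set V) \ {0}).ncard = 2 ^ finrank (ZMod 2) W - 1 := by
  rw [Set.ncard_sdiff_singleton_of_mem W.zero_mem, ncard_submodule]

/-- Cliques without vertices outside `perp Q A`. -/
theorem vecClique_of_subset_perp (hg : ∀ W, TotallySingular Q W → finrank (ZMod 2) W ≤ g + 1)
    (hA : TotallySingular Q A) (hC : IsVecClique Q A C) (h0 : (0 : V) ∉ C)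
    (hCA : C ⊆ perp Q A) :
    C.ncard ≤ 2 ^ (g + 1) - 1 ∧ (C.ncard = 2 ^ (g + 1) - 1 →
      ∃ S, TotallySingular Q S ∧ finrank (ZMod 2) S = g + 1 ∧ A ≤ S ∧ C = (S : Set V) \ {0}) := by
  set W := Submodule.span (ZMod 2) C
  have hW : TotallySingular Q W := totallySingular_span hC.1 fun u hu v hv =>
    (hC.2 u hu v hv).2 fun h => h.elim (fun h => h.2.2 (hCA hv)) fun h => h.2.2 (hCA hu)
  have hsub : C ⊆ (W : Set V) \ {0} := fun v hv =>
    ⟨Submodule.subset_span hv, fun h => h0 (Set.mem_singleton_iff.1 h ▸ hv)⟩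
  have h1 := Set.ncard_le_ncard hsub
  rw [ncard_submodule_diff_zero] at h1
  have h2 : 2 ^ finrank (ZMod 2) W ≤ 2 ^ (g + 1) := Nat.pow_le_pow_right (by norm_num) (hg W hW)
  refine ⟨by omega, fun h => ?_⟩
  have h3 := finrank_eq_of_pow_le (hg W hW) (h ▸ h1)
  refine ⟨W, hW, h3, fun a ha => mem_of_maximal hg hW h3 (hA a ha) ?_,
    Set.eq_of_subset_of_ncard_le hsub ?_⟩
  · exact le_perp_comm (Submodule.span_le.2 hCA) ha
  · rw [ncard_submodule_diff_zero, h3, h]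

theorem two_mul_ncard_inf_perp_le {T : Submodule (ZMod 2) V} {s : Set V} {y : V} (hy : y ∈ T)
    (hyA : y ∉ perp Q s) :
    2 * ((T ⊓ perp Q s : Submodule (ZMod 2) V) : Set V).ncard ≤ (T : Set V).ncard := by
  have h : T ⊓ perp Q s < T := inf_lt_left.2 fun h => hyA (h hy)
  have := Submodule.finrank_lt_finrank_of_lt h
  rw [ncard_submodule, ncard_submodule, ← pow_succ']
  exact Nat.pow_le_pow_right (by norm_num) this

/-- Cliques with a vertex outside `perp Q A`. -/
theorem vecClique_of_notMem_perp (hg : ∀ W, TotallySingular Q W → finrank (ZMod 2) W ≤ g + 1)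
    (hA : TotallySingular Q A) (hAg : finrank (ZMod 2) A ≤ g) (hC : IsVecClique Q A C)
    (h0 : (0 : V) ∉ C) {y : V} (hy : y ∈ C) (hyA : y ∉ perp Q A) :
    C.ncard ≤ 2 ^ (g + 1) - 1 ∧ (C.ncard = 2 ^ (g + 1) - 1 →
      ∃ S P, TotallySingular Q S ∧ finrank (ZMod 2) S = g + 1 ∧ TotallySingular Q P ∧
        finrank (ZMod 2) P = g + 1 ∧ A ≤ S ∧ ¬ A ≤ P ∧
        finrank (ZMod 2) (S ⊓ P : Submodule (ZMod 2) V) = g ∧ C = vecClassB A S P \ {0}) := by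
  have hT := totallySingular_cliqueSpan hA hC
  have hyT := mem_cliqueSpan_of_notMem_perp hy hyA
  have hATT := inf_perp_cliqueSpan_le (Q := Q) (A := A) (C := C)
  have hYT : C \ perp Q A ⊆ (cliqueSpan Q A C : Set V) :=
    fun y hy => mem_cliqueSpan_of_notMem_perp hy.1 hy.2
  have hXT := fun {x x'} => add_mem_cliqueSpan (Q := Q) (A := A) (C := C) (x := x) (x' := x')
  have hCAT : C ∩ A ⊆ (cliqueSpan Q A C : Set V) := fun a ha =>
    inf_perp_le_cliqueSpan ⟨ha.2, fun z hz => (hC.2 a ha.1 z hz.1).2 fun h =>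
      h.elim (fun h => h.2.1 ha.2) fun h => hz.2 h.1⟩
  generalize cliqueSpan Q A C = T at *
  have hTg := hg T hT
  obtain ⟨hS, hSr⟩ := swap_totallySingular hT hA hATT
  set T' := T ⊓ perp Q A with hT'
  have hyT2 : 2 * (T' : Set V).ncard ≤ (T : Set V).ncard := two_mul_ncard_inf_perp_le hyT hyA
  have hTpow : (T : Set V).ncard ≤ 2 ^ (g + 1) := by
    rw [ncard_submodule]; exact Nat.pow_le_pow_right (by norm_num) hTg
  have hTA : (T : Set V) ∩ A ⊆ T' := fun v hv => ⟨hv.1, hA.le_perp hv.2⟩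
  -- the three parts of the clique
  have hsplit1 := Set.ncard_inter_add_ncard_sdiff_eq_ncard C (perp Q A : Set V)
  have hsplit2 := Set.ncard_inter_add_ncard_sdiff_eq_ncard (C ∩ (perp Q A : Set V)) (A : Set V)
  have hCA : C ∩ (perp Q A : Set V) ∩ A ⊆ ((T' : Set V) ∩ A) \ {0} := fun v hv =>
    ⟨⟨hTA ⟨hCAT ⟨hv.1.1, hv.2⟩, hv.2⟩, hv.2⟩, fun h => h0 (Set.mem_singleton_iff.1 h ▸ hv.1.1)⟩
  have hCA' := Set.ncard_le_ncard hCA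
  have hT'0 : (0 : V) ∈ (T' : Set V) ∩ A := ⟨T'.zero_mem, A.zero_mem⟩
  rw [Set.ncard_sdiff_singleton_of_mem hT'0] at hCA'
  have hT'A : 0 < ((T' : Set V) ∩ A).ncard := (Set.ncard_pos (Set.toFinite _)).2 ⟨0, hT'0⟩
  have hT'split := Set.ncard_inter_add_ncard_sdiff_eq_ncard (T' : Set V) (A : Set V)
  have hCY : C \ perp Q A ⊆ (T : Set V) \ T' := fun v hv => ⟨hYT hv, fun h => hv.2 h.2⟩
  have hCY' := Set.ncard_le_ncard hCY
  have hTsplit : (T' : Set V).ncard + ((T : Set V) \ T').ncard = (T : Set V).ncard := by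
    rw [add_comm]
    exact Set.ncard_sdiff_add_ncard_of_subset (SetLike.coe_subset_coe.2 inf_le_left)
  rcases ((C ∩ (perp Q A : Set V)) \ (A : Set V)).eq_empty_or_nonempty with hX | ⟨x, ⟨hx, hxA⟩, hxA'⟩
  · rw [hX, Set.ncard_empty] at hsplit2
    refine ⟨by omega, fun h => ?_⟩
    exfalso
    have h1 : ((T' : Set V) \ A).ncard = 0 := by omega
    rw [Set.ncard_eq_zero, Set.sdiff_eq_empty] at h1
    -- Equality gives T' ≤ A, so A itself has the rank g + 1 of T, against `hAg`.
    rw [sup_eq_right.2 (SetLike.coe_subset_coe.1 h1)] at hSr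
    have h2 := ncard_submodule T
    have h3 := finrank_eq_of_pow_le hTg (by omega)
    omega
  have hCX : ∀ x' ∈ (C ∩ (perp Q A : Set V)) \ (A : Set V), x + x' ∈ T' := fun x' hx' =>
    ⟨hXT hx ⟨hxA, hxA'⟩ hx'.1.1 ⟨hx'.1.2, hx'.2⟩, (perp Q A).add_mem hxA hx'.1.2⟩
  -- First case: x is not orthogonal to T'. Then x + X and C ∩ A both lie in a hyperplane of T', and
  -- Y fills at most half of T \ T'.
  by_cases hxT : ∃ t ∈ T', polar Q x t ≠ 0
  · obtain ⟨t, ht, hxt⟩ := hxT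
    have h1 := two_mul_ncard_inf_perp_le ht (s := {x}) (Q := Q)
      fun h => hxt (by rw [polar_comm]; exact h x rfl)
    have h2 : ((C ∩ (perp Q A : Set V)) \ (A : Set V)).ncard ≤
        ((T' ⊓ perp Q {x} : Submodule (ZMod 2) V) : Set V).ncard := by
      refine Set.ncard_le_ncard_of_injOn (x + ·) (fun x' hx' => ⟨hCX x' hx', ?_⟩)
        (add_right_injective x).injOn
      rintro _ rfl
      rw [polar_add_left, polar_self_eq_zero, polar_comm,
        hC.polar_eq_zero_of_mem_perp hx hx'.1.1 hxA hx'.1.2, add_zero]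
    have h3 : (C ∩ (perp Q A : Set V) ∩ A).ncard ≤
        (((T' ⊓ perp Q {x} : Submodule (ZMod 2) V) : Set V) \ {0}).ncard := by
      refine Set.ncard_le_ncard fun v hv => ⟨⟨(hCA hv).1.1, ?_⟩, (hCA hv).2⟩
      rintro _ rfl
      exact hC.polar_eq_zero_of_mem_perp hv.1.1 hx hv.1.2 hxA
    rw [Set.ncard_sdiff_singleton_of_mem (Submodule.zero_mem _)] at h3
    -- Vectors of Y pair to 1 with x and those of t + Y pair to 0, so these are disjoint subsets of
    -- T \ T' of equal size.
    have h4 : (C \ perp Q A).ncard + ((t + ·) '' (C \ perp Q A)).ncard ≤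
        ((T : Set V) \ T').ncard := by
      rw [← Set.ncard_union_eq]
      · refine Set.ncard_le_ncard (Set.union_subset hCY ?_)
        rintro _ ⟨z, hz, rfl⟩
        exact ⟨T.add_mem ht.1 (hYT hz), fun h => (hCY hz).2 ((T'.add_mem_iff_right ht).1 h)⟩
      · refine Set.disjoint_left.2 ?_
        rintro _ hz' ⟨z, hz, rfl⟩
        have h5 := hC.polar_eq_one hx hz'.1 ⟨hxA, hxA'⟩ hz'.2
        rw [polar_add_right, zmod_two_eq_one hxt,
          hC.polar_eq_one hx hz.1 ⟨hxA, hxA'⟩ hz.2] at h5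
        exact absurd h5 (by decide)
    rw [Set.ncard_image_of_injective _ (add_right_injective t)] at h4
    have h5 : 0 < ((T' ⊓ perp Q {x} : Submodule (ZMod 2) V) : Set V).ncard :=
      (Set.ncard_pos (Set.toFinite _)).2 ⟨0, Submodule.zero_mem _⟩
    have h6 : C.ncard < 2 ^ (g + 1) - 1 := by omega
    exact ⟨h6.le, fun h => absurd h h6.ne⟩
  push Not at hxT
  by_cases hxS : x ∈ T' ⊔ A
  swap
  -- Here x is orthogonal to S but outside it, so S, and with it T, has rank at most g. Then |C| ≤
  -- |T| + |T'| - 1 ≤ (3/2)·2^g - 1.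
  · have h1 : finrank (ZMod 2) (T' ⊔ A : Submodule (ZMod 2) V) ≠ g + 1 := by
      refine fun h => hxS (mem_of_maximal hg hS h (hC.1 x hx) ?_)
      refine fun w hw => ?_
      obtain ⟨t, ht, a, ha, rfl⟩ := Submodule.mem_sup.1 hw
      rw [polar_add_right, hxT t ht, hxA a ha, add_zero]
    have h2 : (T : Set V).ncard ≤ 2 ^ g := by
      rw [ncard_submodule]; exact Nat.pow_le_pow_right (by norm_num) (by omega)
    have h3 : ((C ∩ (perp Q A : Set V)) \ (A : Set V)).ncard ≤ (T' : Set V).ncard :=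
      Set.ncard_le_ncard_of_injOn (x + ·) hCX (add_right_injective x).injOn
    rw [pow_succ]
    have h4 : C.ncard < 2 ^ g * 2 - 1 := by omega
    exact ⟨by omega, fun h => by omega⟩
  -- Translating by the component a of x, instead of by x, still sends X into T' and also keeps it
  -- outside A.
  obtain ⟨t, ht, a, ha, rfl⟩ := Submodule.mem_sup.1 hxS
  have hCX' : ∀ x' ∈ (C ∩ (perp Q A : Set V)) \ (A : Set V), a + x' ∈ (T' : Set V) \ A := by
    intro x' hx'
    refine ⟨?_, fun h => hx'.2 ((A.add_mem_iff_right ha).1 h)⟩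
    have := hCX x' hx'
    rw [add_assoc] at this
    exact (T'.add_mem_iff_right ht).1 this
  have hCXn : ((C ∩ (perp Q A : Set V)) \ (A : Set V)).ncard ≤ ((T' : Set V) \ A).ncard :=
    Set.ncard_le_ncard_of_injOn (a + ·) hCX' (add_right_injective a).injOn
  refine ⟨by omega, fun h => ?_⟩
  have hTn := ncard_submodule T
  have hTr := finrank_eq_of_pow_le hTg (by omega)
  have hYeq : C \ perp Q A = (T : Set V) \ T' := Set.eq_of_subset_of_ncard_le hCY (by omega)
  have hpolar : ∀ x' ∈ (C ∩ (perp Q A : Set V)) \ (A : Set V), ∀ z ∈ T, z ∉ T' → polar Q x' z = 1 := by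
    intro x' hx' z hz hzT
    have hzC : z ∈ C \ perp Q A := hYeq.ge ⟨hz, hzT⟩
    exact hC.polar_eq_one hx'.1.1 hzC.1 ⟨hx'.1.2, hx'.2⟩ hzC.2
  have hyT' : y ∉ T' := fun h => hyA h.2
  have hT'r : finrank (ZMod 2) T' = g := by
    -- All of T \ T' pairs to 1 with x, so the sum of two of its vectors pairs to 0 and lies in T'.
    -- Thus T' has index 2 in T.
    have h1 : ((T : Set V) \ T').ncard ≤ (T' : Set V).ncard := by
      refine Set.ncard_le_ncard_of_injOn (y + ·) (fun z hz => ?_) (add_right_injective y).injOn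
      by_contra hn
      have h1 := hpolar _ ⟨⟨hx, hxA⟩, hxA'⟩ _ (T.add_mem hyT hz.1) hn
      rw [polar_add_right, hpolar _ ⟨⟨hx, hxA⟩, hxA'⟩ y hyT hyT',
        hpolar _ ⟨⟨hx, hxA⟩, hxA'⟩ z hz.1 hz.2] at h1
      exact absurd h1 (by decide)
    have h2 := ncard_submodule T'
    have h3 : 2 ^ finrank (ZMod 2) T' = 2 ^ g := by
      rw [hTr, pow_succ] at hTn
      omega
    exact Nat.pow_right_injective le_rfl h3
  have hinf : (T' ⊔ A) ⊓ T = T' := by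
    refine le_antisymm ?_ (le_inf le_sup_left inf_le_left)
    rintro v ⟨hv, hvT⟩
    obtain ⟨t', ht', a', ha', rfl⟩ := Submodule.mem_sup.1 hv
    exact T'.add_mem ht' (hTA ⟨(T.add_mem_iff_right ht'.1).1 hvT, ha'⟩)
  have hAT : ¬ A ≤ T := fun h => hyA fun w hw => hT.polar_eq_zero hyT (h hw)
  have hSr' := hSr.trans hTr
  have hinf' := hinf.symm ▸ hT'r
  refine ⟨T' ⊔ A, T, hS, hSr', hT, hTr, le_sup_right, hAT, hinf', ?_⟩
  refine Set.eq_of_subset_of_ncard_le (fun v hv => ⟨?_, fun h => h0 (h ▸ hv)⟩) ?_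
  · by_cases hvA : v ∈ perp Q A
    · by_cases hvA' : v ∈ A
      · exact Or.inl (Or.inl ⟨hvA', hCAT ⟨hv, hvA'⟩⟩)
      · refine Or.inl (Or.inr ⟨?_, ?_⟩)
        · have h1 := hCX' v ⟨⟨hv, hvA⟩, hvA'⟩
          have h2 := (T' ⊔ A).add_mem (Submodule.mem_sup_right ha) (Submodule.mem_sup_left h1.1)
          rwa [add_add_cancel_left'] at h2
        · rintro (h1 | h1)
          · exact hvA' h1
          · have := hpolar v ⟨⟨hv, hvA⟩, hvA'⟩ y hyT hyT'
            rw [hT.polar_eq_zero h1 hyT] at this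
            exact absurd this (by decide)
    · exact Or.inr ⟨hYT ⟨hv, hvA⟩, fun h1 => hvA (hinf.le ⟨h1, hYT ⟨hv, hvA⟩⟩).2⟩
  · rw [h, ncard_vecClassB_diff hSr' hTr le_sup_right hAT hinf']

end CliqueBound

end BinaryQuadric


namespace BinaryQuadric

/-! ### From vectors back to points and graphs -/

section Points

open QuadraticMap Module

variable {n : ℕ} {Q : Form n} {A S P W : Space n} {g : ℕ}

/-- The nonzero vector that represents a point. -/
noncomputable def vec (p : QPoint Q) : Fin (n + 1) → ZMod 2 := p.1.rep

theorem vec_ne_zero (p : QPoint Q) : vec p ≠ 0 := p.1.rep_nonzero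

theorem map_vec (p : QPoint Q) : Q (vec p) = 0 := p.2

theorem vec_injective : Function.Injective (vec (Q := Q)) := by
  intro p q h
  apply Subtype.ext
  rw [← p.1.mk_rep, ← q.1.mk_rep]
  congr 1

theorem exists_vec_eq {v : Fin (n + 1) → ZMod 2} (h0 : v ≠ 0) (hv : Q v = 0) :
    ∃ p : QPoint Q, vec p = v := by
  obtain ⟨a, ha⟩ := Projectivization.exists_smul_eq_mk_rep (ZMod 2) v h0
  have ha1 : (a : ZMod 2) = 1 := zmod_two_eq_one a.ne_zero
  have hr : (Projectivization.mk (ZMod 2) v h0).rep = v := by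
    rw [← ha, Units.smul_def, ha1, one_smul]
  exact ⟨⟨Projectivization.mk (ZMod 2) v h0, show Q _ = 0 by rw [hr, hv]⟩, hr⟩

theorem mem_pts {p : QPoint Q} : p ∈ pts Q W ↔ vec p ∈ W := by
  show p.1 ∈ W.projectivization ↔ _
  conv_lhs => rw [← p.1.mk_rep]
  exact Submodule.mk_mem_projectivization_iff W p.1.rep_nonzero

theorem image_vec_preimage {Z : Set (Fin (n + 1) → ZMod 2)} (hZ : ∀ v ∈ Z, Q v = 0) :
    vec (Q := Q) '' (vec ⁻¹' Z) = Z \ {0} := by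
  ext v
  constructor
  · rintro ⟨p, hp, rfl⟩
    exact ⟨hp, vec_ne_zero p⟩
  · rintro ⟨hv, h0⟩
    obtain ⟨p, rfl⟩ := exists_vec_eq h0 (hZ v hv)
    exact ⟨p, hv, rfl⟩

theorem ncard_preimage_vec {Z : Set (Fin (n + 1) → ZMod 2)} (hZ : ∀ v ∈ Z, Q v = 0) :
    (vec (Q := Q) ⁻¹' Z).ncard = (Z \ {0}).ncard := by
  rw [← image_vec_preimage hZ, Set.ncard_image_of_injective _ vec_injective]

theorem eq_preimage_of_image_eq {C : Set (QPoint Q)} {Z : Set (Fin (n + 1) → ZMod 2)}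
    (h : vec '' C = Z \ {0}) : C = vec ⁻¹' Z := by
  rw [← vec_injective.preimage_image C, h]
  ext p
  simp [vec_ne_zero]

theorem pts_eq_preimage : pts Q W = vec ⁻¹' (W : Set _) := Set.ext fun _ => mem_pts

theorem classBSet_eq_preimage : classBSet Q A S P = vec ⁻¹' vecClassB A S P := by
  simp only [classBSet, pts_eq_preimage]
  rfl

theorem pointGraph_adj {p q : QPoint Q} :
    (pointGraph Q).Adj p q ↔ p ≠ q ∧ polar Q (vec p) (vec q) = 0 := by
  refine and_congr_right fun hpq => ⟨?_, fun h => ?_⟩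
  · rintro ⟨L, -, hL, hp, hq⟩
    exact TotallySingular.polar_eq_zero (W := L) hL (mem_pts.1 hp) (mem_pts.1 hq)
  · have hn : vec q ∉ Submodule.span (ZMod 2) {vec p} := by
      intro hq
      obtain ⟨c, hc⟩ := Submodule.mem_span_singleton.1 hq
      have hc0 : c ≠ 0 := by
        rintro rfl
        exact vec_ne_zero q (by rw [← hc, zero_smul])
      rw [zmod_two_eq_one hc0, one_smul] at hc
      exact hpq (vec_injective hc)
    refine ⟨Submodule.span (ZMod 2) {vec p} ⊔ Submodule.span (ZMod 2) {vec q}, ?_, ?_,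
      mem_pts.2 (Submodule.mem_sup_left (Submodule.mem_span_singleton_self _)),
      mem_pts.2 (Submodule.mem_sup_right (Submodule.mem_span_singleton_self _))⟩
    · rw [Submodule.finrank_sup_span_singleton hn, finrank_span_singleton (vec_ne_zero p)]
    · rw [← Submodule.span_union]
      refine totallySingular_span ?_ ?_
      · rintro v (rfl | rfl)
        exacts [map_vec p, map_vec q]
      · rintro u (rfl | rfl) v (rfl | rfl)
        exacts [polar_self_eq_zero _, h, by rw [polar_comm, h], polar_self_eq_zero _]

theorem mem_typeTwo (hA : LiesIn Q A) {p : QPoint Q} :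
    p ∈ typeTwo Q A ↔ vec p ∈ perp Q A ∧ vec p ∉ A := by
  constructor
  · rintro ⟨h1, W, hAW, -, hW, hp⟩
    exact ⟨fun a ha => TotallySingular.polar_eq_zero (W := W) hW (mem_pts.1 hp) (hAW ha),
      fun h => h1 (mem_pts.2 h)⟩
  · rintro ⟨h1, h2⟩
    refine ⟨fun h => h2 (mem_pts.1 h), A ⊔ Submodule.span (ZMod 2) {vec p}, le_sup_left,
      Submodule.finrank_sup_span_singleton h2, ?_,
      mem_pts.2 (Submodule.mem_sup_right (Submodule.mem_span_singleton_self _))⟩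
    have h3 : TotallySingular Q (Submodule.span (ZMod 2) {vec p}) := by
      refine totallySingular_span ?_ ?_
      · rintro v rfl
        exact map_vec p
      · rintro u rfl v rfl
        exact polar_self_eq_zero _
    exact TotallySingular.sup hA h3 (le_perp_comm (by simpa using h1))

theorem neighborSet_inter_typeTwo {y : QPoint Q} (hy : y ∉ typeTwo Q A) :
    (pointGraph Q).neighborSet y ∩ typeTwo Q A =
      {x | x ∈ typeTwo Q A ∧ polar Q (vec x) (vec y) = 0} := by
  ext x
  simp only [Set.mem_inter_iff, SimpleGraph.mem_neighborSet, pointGraph_adj, Set.mem_ofPred_eq]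
  rw [polar_comm Q (vec y)]
  exact ⟨fun h => ⟨h.2, h.1.2⟩, fun h => ⟨⟨fun e => hy (e ▸ h.1), h.2⟩, h.1⟩⟩

/-- Adding a ∈ A with polar(a, y) = 1 preserves the singular vectors of A^⊥ \ A and flips their
pairing with y. -/
theorem halfAdj_of_notMem_perp (hA : LiesIn Q A) {y : QPoint Q} (hy : vec y ∉ perp Q A) :
    HalfAdj (pointGraph Q) (typeTwo Q A) y := by
  have hyX : y ∉ typeTwo Q A := fun h => hy ((mem_typeTwo hA).1 h).1
  refine ⟨hyX, ?_⟩
  rw [neighborSet_inter_typeTwo hyX]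
  obtain ⟨a, ha, hay⟩ : ∃ a ∈ A, polar Q (vec y) a ≠ 0 := by
    by_contra! h
    exact hy h
  have hay1 : polar Q a (vec y) = 1 := by rw [polar_comm]; exact zmod_two_eq_one hay
  set X : Set (Fin (n + 1) → ZMod 2) := {v | Q v = 0 ∧ v ∈ perp Q A ∧ v ∉ A} with hX
  set N : Set (Fin (n + 1) → ZMod 2) := {v | polar Q v (vec y) = 0} with hN
  have hXs : ∀ v ∈ X, a + v ∈ X := fun v hv =>
    ⟨map_add_eq_zero (hA a ha) hv.1 (by rw [polar_comm]; exact hv.2.1 a ha),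
      (perp Q A).add_mem (TotallySingular.le_perp (W := A) hA ha) hv.2.1,
      fun h => hv.2.2 ((A.add_mem_iff_right ha).1 h)⟩
  have e1 : typeTwo Q A = vec ⁻¹' X := by
    ext x
    rw [mem_typeTwo hA]
    exact ⟨fun h => ⟨map_vec x, h⟩, fun h => h.2⟩
  have e2 : {x | x ∈ typeTwo Q A ∧ polar Q (vec x) (vec y) = 0} = vec ⁻¹' (X ∩ N) := by
    rw [e1]
    rfl
  have h0 : (0 : Fin (n + 1) → ZMod 2) ∉ X := fun h => h.2.2 A.zero_mem
  rw [e2, e1, ncard_preimage_vec fun v hv => hv.1.1, ncard_preimage_vec fun v hv => hv.1,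
    Set.sdiff_singleton_eq_self h0, Set.sdiff_singleton_eq_self fun h => h0 h.1,
    ← Set.ncard_inter_add_ncard_sdiff_eq_ncard X N, two_mul]
  congr 1
  refine le_antisymm ?_ ?_
  · refine Set.ncard_le_ncard_of_injOn (a + ·) (fun v hv => ⟨hXs v hv.1, fun h => ?_⟩)
      (add_right_injective a).injOn
    have h1 : polar Q (a + v) (vec y) = 0 := h
    rw [polar_add_left, hay1, show polar Q v (vec y) = 0 from hv.2] at h1
    exact absurd h1 (by decide)
  · refine Set.ncard_le_ncard_of_injOn (a + ·) (fun v hv => ⟨hXs v hv.1, ?_⟩)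
      (add_right_injective a).injOn
    show polar Q (a + v) (vec y) = 0
    rw [polar_add_left, hay1, zmod_two_eq_one hv.2]
    decide

/-- A vertex of A^⊥ outside `typeTwo Q A` lies in A and is adjacent to the whole set. The witness x
is needed: if the set were empty, every vertex would count as adjacent to half of it. -/
theorem notMem_perp_of_halfAdj (hA : LiesIn Q A) {x y : QPoint Q} (hx : x ∈ typeTwo Q A)
    (hy : HalfAdj (pointGraph Q) (typeTwo Q A) y) : vec y ∉ perp Q A := by
  intro h
  have hyA : vec y ∈ A := by
    by_contra hn
    exact hy.1 ((mem_typeTwo hA).2 ⟨h, hn⟩)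
  have h1 := hy.2
  rw [neighborSet_inter_typeTwo hy.1] at h1
  have h2 : {x | x ∈ typeTwo Q A ∧ polar Q (vec x) (vec y) = 0} = typeTwo Q A :=
    Set.sep_eq_self_iff_mem_true.2 fun z hz => ((mem_typeTwo hA).1 hz).1 _ hyA
  rw [h2] at h1
  have h3 : 0 < (typeTwo Q A).ncard := (Set.ncard_pos (Set.toFinite _)).2 ⟨x, hx⟩
  omega

theorem switched_iff (hA : LiesIn Q A) {p q : QPoint Q} :
    Switched (pointGraph Q) (typeTwo Q A) p q ↔ SwitchedVec Q A (vec p) (vec q) := by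
  have key : ∀ p q : QPoint Q, p ∈ typeTwo Q A ∧ HalfAdj (pointGraph Q) (typeTwo Q A) q ↔
      vec p ∈ perp Q A ∧ vec p ∉ A ∧ vec q ∉ perp Q A := by
    intro p q
    rw [← and_assoc, ← mem_typeTwo hA]
    exact and_congr_right fun hp =>
      ⟨notMem_perp_of_halfAdj hA hp, halfAdj_of_notMem_perp hA⟩
  exact or_congr (key p q) (key q p)

theorem gammaGraph_adj (hA : LiesIn Q A) {p q : QPoint Q} (hpq : p ≠ q) :
    (gammaGraph Q A).Adj p q ↔
      (polar Q (vec p) (vec q) = 0 ↔ ¬ SwitchedVec Q A (vec p) (vec q)) := by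
  rw [← switched_iff hA]
  show (_ ∧ ¬ (pointGraph Q).Adj p q) ∨ (_ ∧ (pointGraph Q).Adj p q) ↔ _
  rw [pointGraph_adj]
  tauto

theorem isClique_iff (hA : LiesIn Q A) {C : Set (QPoint Q)} :
    (gammaGraph Q A).IsClique C ↔ IsVecClique Q A (vec '' C) := by
  constructor
  · intro h
    refine ⟨by rintro _ ⟨p, -, rfl⟩; exact map_vec p, ?_⟩
    -- The diagonal does no harm: a vector is orthogonal to itself and never switched with itself.
    rintro _ ⟨p, hp, rfl⟩ _ ⟨q, hq, rfl⟩
    by_cases hpq : p = q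
    · subst hpq
      refine iff_of_true (polar_self_eq_zero _) ?_
      unfold SwitchedVec
      tauto
    · exact (gammaGraph_adj hA hpq).1 (h hp hq hpq)
  · intro h p hp q hq hpq
    exact (gammaGraph_adj hA hpq).2 (h.2 _ ⟨p, hp, rfl⟩ _ ⟨q, hq, rfl⟩)

theorem IsVecClique.mono {V : Type*} [AddCommGroup V] [Module (ZMod 2) V]
    {Q : QuadraticForm (ZMod 2) V} {A : Submodule (ZMod 2) V} {C D : Set V}
    (hD : IsVecClique Q A D) (h : C ⊆ D) : IsVecClique Q A C :=
  ⟨fun u hu => hD.1 u (h hu), fun u hu v hv => hD.2 u (h hu) v (h hv)⟩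

theorem isGClique_preimage (hA : LiesIn Q A) {Z : Set (Fin (n + 1) → ZMod 2)}
    (hZ : IsVecClique Q A Z) (hZn : (Z \ {0}).ncard = 2 ^ (g + 1) - 1) :
    IsGClique Q g A (vec ⁻¹' Z) :=
  ⟨(isClique_iff hA).2 (hZ.mono (Set.image_preimage_subset _ _)),
    (ncard_preimage_vec hZ.1).trans hZn⟩

theorem finrank_le_of_isProjectiveIndex (hg : IsProjectiveIndex Q g) (W : Space n)
    (hW : TotallySingular Q W) : finrank (ZMod 2) W ≤ g + 1 := by
  rcases h : finrank (ZMod 2) W with _ | k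
  · exact Nat.zero_le _
  · exact Nat.succ_le_succ (hg.2 ⟨W, hW, h⟩)

theorem isGClique_of_isClassA (hA : LiesIn Q A) {C : Set (QPoint Q)} (hC : IsClassA Q g A C) :
    IsGClique Q g A C := by
  obtain ⟨S, ⟨hS, hSg⟩, hAS, rfl⟩ := hC
  rw [pts_eq_preimage]
  exact isGClique_preimage hA (isVecClique_of_le hAS hS) (by rw [ncard_submodule_diff_zero, hSg])

theorem isGClique_classBSet (hg : IsProjectiveIndex Q g) (hA : LiesIn Q A)
    (h : IsClassBPair Q g A S P) : IsGClique Q g A (classBSet Q A S P) := by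
  obtain ⟨⟨hS, hSg⟩, ⟨hP, hPg⟩, hAS, hAP, hSP⟩ := h
  rw [classBSet_eq_preimage]
  exact isGClique_preimage hA
    (isVecClique_vecClassB (finrank_le_of_isProjectiveIndex hg) hS hP hPg hAS hAP hSP)
    (ncard_vecClassB_diff hSg hPg hAS hAP hSP)

theorem ncard_parts_classBSet (h : IsClassBPair Q g A S P) {s : ℕ}
    (hAs : finrank (ZMod 2) A = s + 1) :
    (pts Q A ∩ pts Q P).ncard = 2 ^ s - 1 ∧ (pts Q S \ (pts Q A ∪ pts Q P)).ncard = 2 ^ g - 2 ^ s ∧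
      (pts Q P \ pts Q S).ncard = 2 ^ g := by
  obtain ⟨⟨hS, hSg⟩, ⟨hP, hPg⟩, hAS, hAP, hSP⟩ := h
  obtain ⟨h1, h2, h3⟩ := ncard_vecClassB hSg hPg hAS hAP hSP hAs
  simp only [pts_eq_preimage, ← Set.preimage_inter, ← Set.preimage_union, ← Set.preimage_sdiff]
  have h0 : (0 : Fin (n + 1) → ZMod 2) ∈ (A : Set _) ∩ P := ⟨A.zero_mem, P.zero_mem⟩
  rw [ncard_preimage_vec fun v hv => hP v hv.2, ncard_preimage_vec fun v hv => hS v hv.1,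
    ncard_preimage_vec fun v hv => hP v hv.1, Set.ncard_sdiff_singleton_of_mem h0,
    Set.sdiff_singleton_eq_self fun h => h.2 (Or.inl A.zero_mem),
    Set.sdiff_singleton_eq_self fun h => h.2 S.zero_mem, h1, h2, h3]
  exact ⟨rfl, rfl, rfl⟩

theorem ncard_le_and_class_of_isClique (hg : IsProjectiveIndex Q g) (hA : LiesIn Q A)
    (hAg : finrank (ZMod 2) A ≤ g) {C : Set (QPoint Q)} (hC : (gammaGraph Q A).IsClique C) :
    C.ncard ≤ 2 ^ (g + 1) - 1 ∧
      (C.ncard = 2 ^ (g + 1) - 1 → IsClassA Q g A C ∨ IsClassB Q g A C) := by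
  have hC' := (isClique_iff hA).1 hC
  have h0 : (0 : Fin (n + 1) → ZMod 2) ∉ vec '' C := by
    rintro ⟨p, -, hp⟩
    exact vec_ne_zero p hp
  have hg' := finrank_le_of_isProjectiveIndex hg
  rw [← Set.ncard_image_of_injective C vec_injective]
  by_cases hCA : vec '' C ⊆ perp Q A
  · obtain ⟨h1, h2⟩ := vecClique_of_subset_perp hg' hA hC' h0 hCA
    refine ⟨h1, fun h => Or.inl ?_⟩
    obtain ⟨S, hS, hSg, hAS, hCS⟩ := h2 h
    exact ⟨S, ⟨hS, hSg⟩, hAS, by rw [pts_eq_preimage, eq_preimage_of_image_eq hCS]⟩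
  · obtain ⟨y, hy, hyA⟩ := Set.not_subset.1 hCA
    obtain ⟨h1, h2⟩ := vecClique_of_notMem_perp hg' hA hAg hC' h0 hy hyA
    refine ⟨h1, fun h => Or.inr ?_⟩
    obtain ⟨S, P, hS, hSg, hP, hPg, hAS, hAP, hSP, hCS⟩ := h2 h
    exact ⟨S, P, ⟨⟨hS, hSg⟩, ⟨hP, hPg⟩, hAS, hAP, hSP⟩, by
      rw [classBSet_eq_preimage, eq_preimage_of_image_eq hCS]⟩

/-- The clique bound is attained because the index provides one generator, and exchanging part of it
for A gives one through A. -/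
theorem exists_isClassA (hg : IsProjectiveIndex Q g) (hA : LiesIn Q A) :
    ∃ C : Set (QPoint Q), IsClassA Q g A C := by
  obtain ⟨W, hW, hWg⟩ := hg.1
  obtain ⟨G, hG, hGg, hAG⟩ := exists_generator_ge (finrank_le_of_isProjectiveIndex hg) hW hWg hA
  exact ⟨_, G, ⟨hG, hGg⟩, hAG, rfl⟩

theorem cliqueNum_gammaGraph (hg : IsProjectiveIndex Q g) (hA : LiesIn Q A)
    (hAg : finrank (ZMod 2) A ≤ g) : (gammaGraph Q A).cliqueNum = 2 ^ (g + 1) - 1 := by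
  refine le_antisymm ?_ ?_
  · obtain ⟨C, hC⟩ := (gammaGraph Q A).exists_isNClique_cliqueNum
    rw [← hC.card_eq, ← Set.ncard_coe_finset]
    exact (ncard_le_and_class_of_isClique hg hA hAg hC.isClique).1
  · obtain ⟨C, hC⟩ := exists_isClassA hg hA
    obtain ⟨h1, h2⟩ := isGClique_of_isClassA hA hC
    have hf := Set.toFinite C
    rw [← h2, Set.ncard_eq_toFinset_card C hf]
    exact SimpleGraph.IsClique.card_le_cliqueNum (tc := by rwa [hf.coe_toFinset])

end Points

end BinaryQuadric

theorem theorem4p6 (n g s : ℕ) (Q : BinaryQuadric.Form n) (hQ : Q.Nondegenerate)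
    (hg : BinaryQuadric.IsProjectiveIndex Q g) (hs : s < g)
    (A : BinaryQuadric.Space n) (hA : BinaryQuadric.LiesIn Q A)
    (hAs : Module.finrank (ZMod 2) A = s + 1) :
    -- the point set of a generator through `A` is a clique of the stated size
    (∀ C : Set (BinaryQuadric.QPoint Q), BinaryQuadric.IsClassA Q g A C →
      BinaryQuadric.IsGClique Q g A C) ∧
    -- so is each set of Class B, and its three parts have the stated sizes
    (∀ S P : BinaryQuadric.Space n, BinaryQuadric.IsClassBPair Q g A S P →
      (BinaryQuadric.pts Q A ∩ BinaryQuadric.pts Q P).ncard = 2 ^ s - 1 ∧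
      (BinaryQuadric.pts Q S \ (BinaryQuadric.pts Q A ∪ BinaryQuadric.pts Q P)).ncard
        = 2 ^ g - 2 ^ s ∧
      (BinaryQuadric.pts Q P \ BinaryQuadric.pts Q S).ncard = 2 ^ g ∧
      BinaryQuadric.IsGClique Q g A (BinaryQuadric.classBSet Q A S P)) ∧
    -- every clique of this size is of Class A or of Class B
    (∀ C : Set (BinaryQuadric.QPoint Q), BinaryQuadric.IsGClique Q g A C →
      BinaryQuadric.IsClassA Q g A C ∨ BinaryQuadric.IsClassB Q g A C) ∧
    -- this size is the largest size of a clique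
    (BinaryQuadric.gammaGraph Q A).cliqueNum = 2 ^ (g + 1) - 1 ∧
    -- every clique of largest size has this size and is of Class A or of Class B
    (∀ C : Finset (BinaryQuadric.QPoint Q), (BinaryQuadric.gammaGraph Q A).IsMaximumClique C →
      BinaryQuadric.IsGClique Q g A (C : Set (BinaryQuadric.QPoint Q)) ∧
      (BinaryQuadric.IsClassA Q g A (C : Set (BinaryQuadric.QPoint Q)) ∨
        BinaryQuadric.IsClassB Q g A (C : Set (BinaryQuadric.QPoint Q)))) := by
  have hAg : Module.finrank (ZMod 2) A ≤ g := by omega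
  have hclass := fun {C} => BinaryQuadric.ncard_le_and_class_of_isClique hg hA hAg (C := C)
  have hnum := BinaryQuadric.cliqueNum_gammaGraph hg hA hAg
  refine ⟨fun C => BinaryQuadric.isGClique_of_isClassA hA, fun S P h => ?_,
    fun C hC => (hclass hC.1).2 hC.2, hnum, fun C hC => ?_⟩
  · obtain ⟨h1, h2, h3⟩ := BinaryQuadric.ncard_parts_classBSet h hAs
    exact ⟨h1, h2, h3, BinaryQuadric.isGClique_classBSet hg hA h⟩
  · have hCn : (C : Set (BinaryQuadric.QPoint Q)).ncard = 2 ^ (g + 1) - 1 := by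
      rw [Set.ncard_coe_finset, SimpleGraph.maximumClique_card_eq_cliqueNum C hC, hnum]
    exact ⟨⟨hC.1, hCn⟩, (hclass hC.1).2 hCn⟩
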